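/- Let $D\subset\mathbb{C}^n$ be a bounded domain (a bounded non-empty connected open set) and let $A\subset\partial D$ be compact. Let $\operatorname{PSH}(D)^-$ be the family of plurisubharmonic functions $u:D\to[-\infty,0]$ (the function $u\equiv-\infty$ being admitted), and put $u^*(\zeta)=\limsup_{z\to\zeta,\,z\in D}u(z)$ for $\zeta\in\overline D$. For $z\in D$ define \[\omega(z,A,D)=\sup\{u(z): u\in\operatorname{PSH}(D)^-,\ u^*\le-1 \text{ on } A\},\] \[\omega^c(z,A,D)=\sup\{u(z): u\in\operatorname{PSH}(D)^-\cap C(\overline D),\ u\le-1 \text{ on } A\},\] where $C(\overline D)$ denotes the real-valued continuous functions on $\overline D$. Assume that at least one of the following holds: (a) $D$ is B-regular, i.e. every continuous function $f:\partial D\to\mathbb{R}$ extends to a continuous function on $\overline D$ that is plurisubharmonic in $D$; (b) $D$ is strongly star shaped with respect to the origin, i.e. $r\overline D\subset D$ for all $0<r<1$; (c) $D$ is a polydisc, i.e. a product of $n$ open discs of arbitrary centres and positive finite radii. Then $\omega(z,A,D)=\omega^c(z,A,D)$ for every $z\in D$. -/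

import Mathlib

open Set Filter Topology MeasureTheory

noncomputable section

namespace PluriExtremal

/-- The integral of an extended-real function with respect to a measure: the integral of the
positive part minus that of the negative part.  It is a genuine element of `[-∞, ∞)` as soon as
the positive part has finite integral, which is always so in its only use below, because an upper
semicontinuous function without the value `+∞` is bounded above on a circle. -/
def eintegral {X : Type*} [MeasurableSpace X] (μ : Measure X) (f : X → EReal) : EReal :=
  ((∫⁻ x, (f x).toENNReal ∂μ : ENNReal) : EReal) - ((∫⁻ x, (-f x).toENNReal ∂μ : ENNReal) : EReal)

/-- The normalized arc length `dθ / 2π` on `(0, 2π]`. -/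
def arcMeasure : Measure ℝ :=
  ENNReal.ofReal (2 * Real.pi)⁻¹ • volume.restrict (Ioc 0 (2 * Real.pi))

/-- `u` is plurisubharmonic on the open set `D ⊆ ℂⁿ`: it takes values in `[-∞, ∞)`, is upper
semicontinuous, and satisfies the sub-mean value inequality on each closed disc (in a complex
line) contained in `D`.  The function that is identically `-∞` is admitted.  The values of `u`
outside `D` play no role. -/
structure IsPSH {n : ℕ} (D : Set (Fin n → ℂ)) (u : (Fin n → ℂ) → EReal) : Prop where
  lt_top : ∀ z ∈ D, u z < ⊤
  usc : UpperSemicontinuousOn u D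
  submean : ∀ a b : Fin n → ℂ, (∀ w : ℂ, ‖w‖ ≤ 1 → a + w • b ∈ D) →
    u a ≤ eintegral arcMeasure (fun θ : ℝ => u (a + Complex.exp (θ * Complex.I) • b))

/-- `u* (ζ) = limsup u(z)` as `z → ζ`, `z ∈ D`. -/
def upperReg {n : ℕ} (D : Set (Fin n → ℂ)) (u : (Fin n → ℂ) → EReal) (ζ : Fin n → ℂ) : EReal :=
  limsup u (𝓝[D] ζ)

/-- The boundary relative extremal function `ω(z, A, D)`. -/
def omega {n : ℕ} (z : Fin n → ℂ) (A D : Set (Fin n → ℂ)) : EReal :=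
  sSup {t | ∃ u : (Fin n → ℂ) → EReal, IsPSH D u ∧ (∀ w ∈ D, u w ≤ 0) ∧
    (∀ ζ ∈ A, upperReg D u ζ ≤ -1) ∧ t = u z}

/-- The boundary relative extremal function `ωᶜ(z, A, D)`, formed with the non-positive
plurisubharmonic functions on `D` that are (real-valued and) continuous on the closure of `D`. -/
def omegaC {n : ℕ} (z : Fin n → ℂ) (A D : Set (Fin n → ℂ)) : EReal :=
  sSup {t | ∃ u : (Fin n → ℂ) → ℝ, IsPSH D (fun w => (u w : EReal)) ∧ (∀ w ∈ D, u w ≤ 0) ∧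
    ContinuousOn u (closure D) ∧ (∀ ζ ∈ A, u ζ ≤ -1) ∧ t = (u z : EReal)}

/-- B-regularity: every real continuous function on the boundary extends to a function that is
continuous on the closure and plurisubharmonic inside. -/
def IsBRegular {n : ℕ} (D : Set (Fin n → ℂ)) : Prop :=
  ∀ f : (Fin n → ℂ) → ℝ, ContinuousOn f (frontier D) →
    ∃ u : (Fin n → ℂ) → ℝ, ContinuousOn u (closure D) ∧ IsPSH D (fun z => (u z : EReal)) ∧
      EqOn u f (frontier D)

/-- `D` is strongly star shaped with respect to the origin. -/
def IsStronglyStarShaped {n : ℕ} (D : Set (Fin n → ℂ)) : Prop :=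
  ∀ r : ℝ, 0 < r → r < 1 → ∀ z ∈ closure D, r • z ∈ D

/-- `D` is a polydisc: a product of `n` open discs of arbitrary centres and radii. -/
def IsPolydisc {n : ℕ} (D : Set (Fin n → ℂ)) : Prop :=
  ∃ (c : Fin n → ℂ) (r : Fin n → ℝ), (∀ i, 0 < r i) ∧ D = {z | ∀ i, ‖z i - c i‖ < r i}

end PluriExtremal

end

/-!
Only `ω ≤ ωᶜ` needs proof. Given a competitor `u` for `ω`, the function `v = max u (-1)` is bounded
and plurisubharmonic, and by compactness `v ≤ -1 + ε` on `D` near `A`. It is regularized from above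
by the Lipschitz sup-convolution `v_K z = sup_{y ∈ D} (v y - K |z - y|)`, which is continuous on all
of space and plurisubharmonic at distance at least `1 / K` from the complement of `D`, because there
the points `y` that matter are translates of `z` inside `D`.

If `D` is strongly star shaped about `c`, then `v_K ∘ H - ε` is a continuous competitor for a
contraction `H` towards `c` close to the identity. It is large at `z` because a bounded subharmonic
function on a plane domain satisfies `f 0 ≤ limsup f t` as `t → 0⁺`: on a slit disc, `f` is
compared by the maximum principle with the real part of a branch of the square root.

If `D` is B-regular, let `χ` be a continuous cutoff with `χ = 1` on `A` that vanishes away from `A`,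
and let `U`, `W` be the extensions of `-χ`, `χ`. The maximum principle gives `v ≤ ε - W`, and
`-W` is close to `U` near the boundary. Hence `v_K - 3 ε ≤ U` near the boundary, and
`max (v_K - 3 ε) U` is plurisubharmonic on `D` and continuous on the closure.
-/

namespace PluriExtremal

open Real Metric Bornology

variable {E F : Type*} [NormedAddCommGroup E] [NormedSpace ℂ E]
  [NormedAddCommGroup F] [NormedSpace ℂ F] {Ω D : Set E} {u v : E → ℝ} {a b : E}

/-- `v` is a bounded plurisubharmonic function on `Ω`. The sub-mean value inequality is only asked
on small circles, so that the property is local; `IsBddPSH.le_circleAverage` extends it to all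
discs. The values of `v` outside `Ω` play no role. -/
structure IsBddPSH (Ω : Set E) (v : E → ℝ) : Prop where
  bdd : ∃ C, ∀ z ∈ Ω, |v z| ≤ C
  usc : UpperSemicontinuousOn v Ω
  submean : ∀ a ∈ Ω, ∀ b, ∀ᶠ r : ℝ in 𝓝[>] 0,
    v a ≤ circleAverage (fun w : ℂ => v (a + w • b)) 0 r

section Basic

theorem circleIntegrable_slice (hb : ∃ C, ∀ z ∈ Ω, |v z| ≤ C) (hu : UpperSemicontinuousOn v Ω)
    {r : ℝ} (h : ∀ w ∈ sphere (0 : ℂ) |r|, a + w • b ∈ Ω) :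
    CircleIntegrable (fun w : ℂ => v (a + w • b)) 0 r := by
  obtain ⟨C, hC⟩ := hb
  have hmem (θ : ℝ) : a + circleMap 0 r θ • b ∈ Ω := h _ (circleMap_mem_sphere' 0 r θ)
  have hcont : Continuous fun θ : ℝ => a + circleMap 0 r θ • b := by
    have := continuous_circleMap 0 r
    fun_prop
  have husc : UpperSemicontinuous fun θ : ℝ => v (a + circleMap 0 r θ • b) := fun θ y hy =>
    (tendsto_nhdsWithin_iff.2 ⟨hcont.continuousAt, .of_forall hmem⟩).eventually
      (hu _ (hmem θ) y hy)
  rw [CircleIntegrable, intervalIntegrable_iff]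
  exact Measure.integrableOn_of_bounded (M := C) (by simp [ENNReal.mul_eq_top])
    husc.measurable.aestronglyMeasurable (.of_forall fun θ => hC _ (hmem θ))

theorem eventually_disc_subset (hΩ : IsOpen Ω) (ha : a ∈ Ω) (b : E) :
    ∀ᶠ r : ℝ in 𝓝[>] 0, ∀ w : ℂ, ‖w‖ ≤ r → a + w • b ∈ Ω := by
  have hcont : Continuous fun w : ℂ => a + w • b := by fun_prop
  obtain ⟨ε, hε, hball⟩ := Metric.mem_nhds_iff.1
    (hcont.continuousAt.preimage_mem_nhds (x := 0) (hΩ.mem_nhds (by simpa using ha)))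
  filter_upwards [Ioo_mem_nhdsGT hε] with r hr w hw
  exact hball (by simpa using hw.trans_lt hr.2)

theorem eventually_circleIntegrable (hΩ : IsOpen Ω) (hb : ∃ C, ∀ z ∈ Ω, |v z| ≤ C)
    (hu : UpperSemicontinuousOn v Ω) (ha : a ∈ Ω) (b : E) :
    ∀ᶠ r : ℝ in 𝓝[>] 0, CircleIntegrable (fun w : ℂ => v (a + w • b)) 0 r := by
  filter_upwards [eventually_disc_subset hΩ ha b, self_mem_nhdsWithin] with r hr (hr0 : 0 < r)
  refine circleIntegrable_slice hb hu fun w hw => hr w ?_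
  rw [abs_of_pos hr0] at hw
  exact (mem_sphere_zero_iff_norm.1 hw).le

theorem circleAverage_slice (v : E → ℝ) (a b : E) (r : ℝ) :
    circleAverage (fun w : ℂ => v (a + w • b)) 0 r =
      circleAverage (fun w : ℂ => v (a + w • (r : ℂ) • b)) 0 1 := by
  rw [circleAverage_eq_circleAverage_zero_one]
  simp only [add_zero, smul_smul, mul_comm]

theorem IsBddPSH.of_le_circleAverage (hΩ : IsOpen Ω) (hb : ∃ C, ∀ z ∈ Ω, |v z| ≤ C)
    (hu : UpperSemicontinuousOn v Ω)
    (h : ∀ a b : E, (∀ w : ℂ, ‖w‖ ≤ 1 → a + w • b ∈ Ω) →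
      v a ≤ circleAverage (fun w : ℂ => v (a + w • b)) 0 1) : IsBddPSH Ω v where
  bdd := hb
  usc := hu
  submean a ha b := by
    filter_upwards [eventually_disc_subset hΩ ha b, self_mem_nhdsWithin] with r hr (hr0 : 0 < r)
    rw [circleAverage_slice]
    refine h _ _ fun w hw => ?_
    rw [smul_smul]
    refine hr _ ?_
    rw [norm_mul, Complex.norm_real, norm_of_nonneg hr0.le]
    exact mul_le_of_le_one_left hr0.le hw

theorem IsBddPSH.mono (hv : IsBddPSH Ω v) (h : D ⊆ Ω) : IsBddPSH D v where
  bdd := hv.bdd.imp fun _ hC z hz => hC z (h hz)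
  usc := hv.usc.mono h
  submean a ha b := hv.submean a (h ha) b

theorem isBddPSH_const (Ω : Set E) (c : ℝ) : IsBddPSH Ω fun _ => c where
  bdd := ⟨|c|, fun _ _ => le_rfl⟩
  usc := continuousOn_const.upperSemicontinuousOn
  submean _ _ _ := by simp only [circleAverage_const, le_refl, eventually_true]

theorem IsBddPSH.add (hΩ : IsOpen Ω) (hu : IsBddPSH Ω u) (hv : IsBddPSH Ω v) :
    IsBddPSH Ω fun z => u z + v z where
  bdd := by
    obtain ⟨C, hC⟩ := hu.bdd
    obtain ⟨C', hC'⟩ := hv.bdd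
    exact ⟨C + C', fun z hz => (abs_add_le _ _).trans (add_le_add (hC z hz) (hC' z hz))⟩
  usc := hu.usc.add hv.usc
  submean a ha b := by
    filter_upwards [hu.submean a ha b, hv.submean a ha b,
      eventually_circleIntegrable hΩ hu.bdd hu.usc ha b,
      eventually_circleIntegrable hΩ hv.bdd hv.usc ha b] with r h1 h2 h3 h4
    rw [circleAverage_fun_add h3 h4]
    exact add_le_add h1 h2

theorem IsBddPSH.sub_const (hΩ : IsOpen Ω) (hv : IsBddPSH Ω v) (c : ℝ) :
    IsBddPSH Ω fun z => v z - c := by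
  simpa only [sub_eq_add_neg] using hv.add hΩ (isBddPSH_const Ω (-c))

theorem IsBddPSH.sup (hΩ : IsOpen Ω) (hu : IsBddPSH Ω u) (hv : IsBddPSH Ω v) :
    IsBddPSH Ω fun z => max (u z) (v z) := by
  have hbdd : ∃ C, ∀ z ∈ Ω, |max (u z) (v z)| ≤ C := by
    obtain ⟨C, hC⟩ := hu.bdd
    obtain ⟨C', hC'⟩ := hv.bdd
    exact ⟨max C C', fun z hz =>
      abs_max_le_max_abs_abs.trans (max_le_max (hC z hz) (hC' z hz))⟩
  have husc : UpperSemicontinuousOn (fun z => max (u z) (v z)) Ω := hu.usc.sup hv.usc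
  refine ⟨hbdd, husc, fun a ha b => ?_⟩
  filter_upwards [hu.submean a ha b, hv.submean a ha b,
    eventually_circleIntegrable hΩ hu.bdd hu.usc ha b,
    eventually_circleIntegrable hΩ hv.bdd hv.usc ha b,
    eventually_circleIntegrable hΩ hbdd husc ha b] with r h1 h2 h3 h4 h5
  exact max_le (h1.trans (circleAverage_mono h3 h5 fun _ _ => le_max_left _ _))
    (h2.trans (circleAverage_mono h4 h5 fun _ _ => le_max_right _ _))

theorem IsBddPSH.comp_affineMap (hv : IsBddPSH Ω v) (f : F →ᵃ[ℂ] E) (hf : Continuous f) :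
    IsBddPSH (f ⁻¹' Ω) (v ∘ f) where
  bdd := hv.bdd.imp fun _ hC z hz => hC _ hz
  usc := hv.usc.comp hf.continuousOn fun _ hz => hz
  submean z hz b := by
    have h (w : ℂ) : f (z + w • b) = f z + w • f.linear b := by
      rw [add_comm z, ← vadd_eq_add, f.map_vadd, map_smul, vadd_eq_add, add_comm]
    simpa only [Function.comp_apply, h] using hv.submean _ hz (f.linear b)

theorem IsBddPSH.comp_line (hv : IsBddPSH Ω v) (a b : E) :
    IsBddPSH ((fun w : ℂ => a + w • b) ⁻¹' Ω) fun w : ℂ => v (a + w • b) := by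
  have h : ⇑(AffineMap.lineMap a (a + b) : ℂ →ᵃ[ℂ] E) = fun w => a + w • b := by
    ext w
    simp [AffineMap.lineMap_apply, add_comm]
  simpa only [h, Function.comp_def] using
    hv.comp_affineMap (AffineMap.lineMap a (a + b)) AffineMap.lineMap_continuous

theorem isBddPSH_of_locally (hb : ∃ C, ∀ z ∈ Ω, |v z| ≤ C)
    (h : ∀ z ∈ Ω, ∃ N, IsOpen N ∧ z ∈ N ∧ ∃ g, IsBddPSH N g ∧ EqOn v g N) : IsBddPSH Ω v where
  bdd := hb
  usc z hz := by
    obtain ⟨N, hN, hzN, g, hg, heq⟩ := h z hz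
    have hvN : UpperSemicontinuousOn v N := fun x hx y hy => by
      filter_upwards [hg.usc x hx y ((heq hx).symm.trans_lt hy), self_mem_nhdsWithin]
        with x' hx' hx'N
      exact (heq hx'N).trans_lt hx'
    have hvz : UpperSemicontinuousAt v z := fun y hy => by
      simpa only [hN.nhdsWithin_eq hzN] using hvN z hzN y hy
    exact hvz.upperSemicontinuousWithinAt Ω
  submean a ha b := by
    obtain ⟨N, hN, haN, g, hg, heq⟩ := h a ha
    filter_upwards [hg.submean a haN b, eventually_disc_subset hN haN b, self_mem_nhdsWithin]
      with r hr hdisc (hr0 : 0 < r)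
    rw [heq haN]
    refine hr.trans_eq (circleAverage_congr_sphere fun w hw => (heq (hdisc w ?_)).symm)
    rw [abs_of_pos hr0] at hw
    exact (mem_sphere_zero_iff_norm.1 hw).le

end Basic

section MaximumPrinciple

theorem circleAverage_re_of_differentiableOn {g : ℂ → ℂ} {c : ℂ} {r : ℝ} (hr : 0 ≤ r)
    (hg : DifferentiableOn ℂ g (closedBall c r)) :
    circleAverage (fun w => (g w).re) c r = (g c).re := by
  have hd : DiffContOnCl ℂ g (ball c |r|) := by
    rw [abs_of_nonneg hr]
    exact hg.diffContOnCl_ball le_rfl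
  rw [← hd.circleAverage]
  exact Complex.reCLM.circleAverage_comp_comm
    ((hg.continuousOn.mono sphere_subset_closedBall).circleIntegrable hr)

theorem isBddPSH_re {g : ℂ → ℂ} {Ω : Set ℂ} (hΩ : IsOpen Ω) (hg : DifferentiableOn ℂ g Ω)
    (hb : ∃ C, ∀ z ∈ Ω, |(g z).re| ≤ C) : IsBddPSH Ω fun w => (g w).re := by
  refine .of_le_circleAverage hΩ hb
    (Complex.continuous_re.comp_continuousOn hg.continuousOn).upperSemicontinuousOn
    fun a b hdisc => ?_
  rw [circleAverage_re_of_differentiableOn zero_le_one (g := fun w => g (a + w • b))]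
  · simp only [zero_smul, add_zero, le_refl]
  · exact hg.comp (by fun_prop) fun w hw => hdisc w (mem_closedBall_zero_iff.1 hw)

theorem circleAverage_normSq_affine (α β : ℂ) {r : ℝ} (hr : 0 ≤ r) :
    circleAverage (fun w => ‖α + w * β‖ ^ 2) 0 r = ‖α‖ ^ 2 + r ^ 2 * ‖β‖ ^ 2 := by
  have hsphere : EqOn (fun w : ℂ => ‖α + w * β‖ ^ 2)
      (fun w => ((‖α‖ ^ 2 + r ^ 2 * ‖β‖ ^ 2 : ℝ) + 2 * starRingEnd ℂ α * (w * β) : ℂ).re)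
      (sphere 0 |r|) := fun w hw => by
    have hw' : ‖w‖ = r := by simpa [abs_of_nonneg hr] using hw
    simp only [← hw', ← Complex.normSq_eq_norm_sq, Complex.normSq_apply, Complex.add_re,
      Complex.add_im, Complex.mul_re, Complex.mul_im, Complex.ofReal_re, Complex.conj_re,
      Complex.conj_im, Complex.re_ofNat, Complex.im_ofNat]
    ring
  rw [circleAverage_congr_sphere hsphere, circleAverage_re_of_differentiableOn hr (by fun_prop)]
  rw [zero_mul, mul_zero, add_zero, Complex.ofReal_re]

theorem isCompact_superlevel {X : Type*} [PseudoMetricSpace X] [ProperSpace X] {Ω : Set X}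
    (hΩ : IsOpen Ω) (hbd : IsBounded Ω) {v : X → ℝ} (hu : UpperSemicontinuousOn v Ω) {c : ℝ}
    (hfr : ∀ ζ ∈ frontier Ω, ∀ᶠ z in 𝓝[Ω] ζ, v z < c) : IsCompact {z ∈ Ω | c ≤ v z} := by
  refine Metric.isCompact_of_isClosed_isBounded (isClosed_of_closure_subset fun z hz => ?_)
    (hbd.subset fun z hz => hz.1)
  have hnot : ¬ ∀ᶠ y in 𝓝[Ω] z, v y < c := fun h => by
    obtain ⟨y, hy, hlt⟩ :=
      ((mem_closure_iff_frequently.1 hz).and_eventually (eventually_nhdsWithin_iff.1 h)).exists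
    exact (hlt hy.1).not_ge hy.2
  have hzΩ : z ∈ Ω := by
    by_contra hzΩ
    exact hnot (hfr z ⟨closure_mono (fun _ h => h.1) hz, by rwa [hΩ.interior_eq]⟩)
  exact ⟨hzΩ, not_lt.1 fun h => hnot (hu z hzΩ c h)⟩

theorem exists_isMaxOn_of_frontier {X : Type*} [PseudoMetricSpace X] [ProperSpace X] {Ω : Set X}
    (hΩ : IsOpen Ω) (hbd : IsBounded Ω) {v : X → ℝ} (hu : UpperSemicontinuousOn v Ω) {z₀ : X}
    (hz₀ : z₀ ∈ Ω) (hfr : ∀ ζ ∈ frontier Ω, ∀ᶠ z in 𝓝[Ω] ζ, v z < v z₀) :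
    ∃ z₁ ∈ Ω, IsMaxOn v Ω z₁ := by
  obtain ⟨z₁, ⟨hz₁, hle⟩, hmax⟩ := UpperSemicontinuousOn.exists_isMaxOn
    (s := {z ∈ Ω | v z₀ ≤ v z}) ⟨z₀, hz₀, le_rfl⟩ (isCompact_superlevel hΩ hbd hu hfr)
    (hu.mono fun z hz => hz.1)
  refine ⟨z₁, hz₁, fun z hz => ?_⟩
  obtain h | h := le_total (v z₀) (v z)
  · exact hmax ⟨hz, h⟩
  · exact h.trans hle

theorem IsBddPSH.not_isMaxOn_add_normSq (hΩ : IsOpen Ω) (hv : IsBddPSH Ω v) (ℓ : StrongDual ℂ E)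
    (hℓ : ℓ ≠ 0) {δ : ℝ} (hδ : 0 < δ) (ha : a ∈ Ω) :
    ¬ IsMaxOn (fun z => v z + δ * ‖ℓ z‖ ^ 2) Ω a := fun hmax => by
  obtain ⟨e, he⟩ := DFunLike.ne_iff.1 hℓ
  obtain ⟨r, hsub, hdisc, hint, hr⟩ := ((hv.submean a ha e).and
    ((eventually_disc_subset hΩ ha e).and ((eventually_circleIntegrable hΩ hv.bdd hv.usc ha e).and
      self_mem_nhdsWithin))).exists
  replace hr : 0 < r := hr
  have hint' : CircleIntegrable (fun w : ℂ => δ * ‖ℓ a + w * ℓ e‖ ^ 2) 0 r :=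
    (Continuous.continuousOn (by fun_prop)).circleIntegrable hr.le
  have havg : circleAverage (fun w : ℂ => v (a + w • e) + δ * ‖ℓ a + w * ℓ e‖ ^ 2) 0 r
      ≤ v a + δ * ‖ℓ a‖ ^ 2 := by
    refine circleAverage_mono_on_of_le_circle (hint.add hint') fun w hw => ?_
    have hw' : ‖w‖ ≤ r := by simpa [abs_of_pos hr] using (mem_sphere_zero_iff_norm.1 hw).le
    simpa using hmax (hdisc w hw')
  have hsq : circleAverage (fun w : ℂ => δ * ‖ℓ a + w * ℓ e‖ ^ 2) 0 r
      = δ * (‖ℓ a‖ ^ 2 + r ^ 2 * ‖ℓ e‖ ^ 2) := by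
    rw [← circleAverage_normSq_affine _ _ hr.le, ← smul_eq_mul, ← circleAverage_fun_smul]
    rfl
  rw [circleAverage_fun_add hint hint', hsq] at havg
  have : 0 < δ * (r ^ 2 * ‖ℓ e‖ ^ 2) := by
    have := norm_pos_iff.2 he
    positivity
  linarith

/-- A small multiple of `‖ℓ z‖ ^ 2`, with `ℓ ≠ 0` linear, makes the sub-mean value inequality
strict in some direction, hence excludes an interior maximum. -/
theorem IsBddPSH.nonpos_of_frontier [ProperSpace E] [Nontrivial E] (hΩ : IsOpen Ω)
    (hbd : IsBounded Ω) (hv : IsBddPSH Ω v)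
    (hfr : ∀ ζ ∈ frontier Ω, ∀ ε > 0, ∀ᶠ z in 𝓝[Ω] ζ, v z < ε) : ∀ z ∈ Ω, v z ≤ 0 := by
  obtain ⟨ℓ, hℓ⟩ := exists_ne (0 : StrongDual ℂ E)
  obtain ⟨R, hR⟩ := hbd.isCompact_closure.exists_bound_of_continuousOn
    (f := fun z => ‖ℓ z‖ ^ 2) (by fun_prop)
  by_contra! ⟨z₀, hz₀, hpos⟩
  have hR0 : 0 ≤ R := (norm_nonneg _).trans (hR z₀ (subset_closure hz₀))
  obtain ⟨δ, hδ, hδR⟩ : ∃ δ > 0, δ * R < v z₀ / 2 := by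
    refine ⟨v z₀ / (2 * (R + 1)), by positivity, ?_⟩
    rw [div_mul_eq_mul_div, div_lt_div_iff₀ (by positivity) two_pos]
    nlinarith
  have hfr' : ∀ ζ ∈ frontier Ω, ∀ᶠ z in 𝓝[Ω] ζ, v z + δ * ‖ℓ z‖ ^ 2 < v z₀ + δ * ‖ℓ z₀‖ ^ 2 := by
    intro ζ hζ
    filter_upwards [hfr ζ hζ _ (half_pos hpos), self_mem_nhdsWithin] with z hz hzΩ
    have h1 := mul_le_mul_of_nonneg_left ((le_abs_self _).trans (hR z (subset_closure hzΩ))) hδ.le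
    have h2 : 0 ≤ δ * ‖ℓ z₀‖ ^ 2 := by positivity
    linarith
  obtain ⟨z₁, hz₁, hmax⟩ := exists_isMaxOn_of_frontier hΩ hbd
    (hv.usc.add (Continuous.continuousOn (by fun_prop)).upperSemicontinuousOn) hz₀ hfr'
  exact hv.not_isMaxOn_add_normSq hΩ ℓ hℓ hδ hz₁ hmax

end MaximumPrinciple

section SupConvolution

variable {X : Type*} [PseudoMetricSpace X] {D : Set X} {v : X → ℝ} {z : X} {K ρ m M : ℝ}

/-- The Lipschitz sup-convolution of `v` on `D`: the upper envelope of the cones of slope `K` with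
apex on the graph of `v` over `D`. It is a `K`-Lipschitz majorant of `v`, meaningful when `v` is
bounded above on the non-empty set `D`. -/
noncomputable def supConv (D : Set X) (v : X → ℝ) (K : ℝ) (z : X) : ℝ :=
  ⨆ y : D, (v y - K * dist z y)

theorem sub_mul_dist_le_supConv (hM : ∀ y ∈ D, v y ≤ M) (hK : 0 ≤ K) {y : X} (hy : y ∈ D) :
    v y - K * dist z y ≤ supConv D v K z := by
  refine le_ciSup (f := fun y : D => v y - K * dist z y) ⟨M, ?_⟩ ⟨y, hy⟩
  rintro _ ⟨x, rfl⟩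
  exact (sub_le_self _ (by positivity)).trans (hM x x.2)

theorem le_supConv (hM : ∀ y ∈ D, v y ≤ M) (hK : 0 ≤ K) (hz : z ∈ D) : v z ≤ supConv D v K z := by
  simpa using sub_mul_dist_le_supConv (z := z) hM hK hz

theorem supConv_le (hD : D.Nonempty) {c : ℝ} (h : ∀ y ∈ D, v y ≤ c + K * dist z y) :
    supConv D v K z ≤ c :=
  have := hD.to_subtype
  ciSup_le fun y => sub_le_iff_le_add.2 (h y y.2)

theorem supConv_le_of_ball (hD : D.Nonempty) (hM : ∀ y ∈ D, v y ≤ M) (hK : 0 ≤ K) {c : ℝ}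
    (hMc : M ≤ c + K * ρ) (h : ∀ y ∈ D ∩ ball z ρ, v y ≤ c) : supConv D v K z ≤ c := by
  refine supConv_le hD fun y hy => ?_
  obtain hyz | hyz := lt_or_ge (dist y z) ρ
  · exact (h y ⟨hy, hyz⟩).trans (le_add_of_nonneg_right (by positivity))
  · rw [dist_comm] at hyz
    exact (hM y hy).trans (hMc.trans (by gcongr))

theorem lipschitzWith_supConv (hD : D.Nonempty) (hM : ∀ y ∈ D, v y ≤ M) (K : NNReal) :
    LipschitzWith K (supConv D v K) := by
  refine LipschitzWith.of_le_add_mul K fun x z => supConv_le hD fun y hy => ?_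
  have h := sub_mul_dist_le_supConv (z := z) hM K.coe_nonneg hy
  have htri := mul_le_mul_of_nonneg_left (dist_triangle_left z y x) K.coe_nonneg
  linarith

theorem tendsto_supConv (hv : UpperSemicontinuousOn v D) (hM : ∀ y ∈ D, v y ≤ M) (hz : z ∈ D) :
    Tendsto (fun k : ℕ => supConv D v k z) atTop (𝓝 (v z)) := by
  refine tendsto_order.2 ⟨fun c hc => .of_forall fun k =>
    hc.trans_le (le_supConv hM k.cast_nonneg hz), fun c hc => ?_⟩
  obtain ⟨c', hvc', hc'⟩ := exists_between hc
  obtain ⟨ρ, hρ, hball⟩ := Metric.mem_nhdsWithin_iff.1 (hv z hz c' hvc')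
  filter_upwards [eventually_ge_atTop ⌈(M - c') / ρ⌉₊] with k hk
  refine (supConv_le_of_ball ⟨z, hz⟩ hM k.cast_nonneg ?_
    fun y hy => (hball ⟨hy.2, hy.1⟩).le).trans_lt hc'
  have := (div_le_iff₀ hρ).1 (Nat.ceil_le.1 hk)
  linarith

end SupConvolution

section LocalToGlobal

theorem exists_entire_of_mem_span_fourier {T : C(AddCircle (2 * π), ℂ)}
    (hT : T ∈ Submodule.span ℂ (range <| @fourier (2 * π))) :
    ∃ p q : ℂ → ℂ, Differentiable ℂ p ∧ Differentiable ℂ q ∧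
      ∀ θ : ℝ, T θ = p (circleMap 0 1 θ) + (starRingEnd ℂ) (q (circleMap 0 1 θ)) := by
  have hpow (n : ℕ) (θ : ℝ) : circleMap 0 1 θ ^ n = Complex.exp (n * θ * Complex.I) := by
    rw [circleMap_zero, Complex.ofReal_one, one_mul, ← Complex.exp_nat_mul, mul_assoc]
  have hfourier (n : ℤ) (θ : ℝ) :
      fourier n (θ : AddCircle (2 * π)) = Complex.exp (n * θ * Complex.I) := by
    rw [fourier_coe_apply]
    congr 1
    have : (π : ℂ) ≠ 0 := by exact_mod_cast pi_ne_zero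
    push_cast
    field_simp
  induction hT using Submodule.span_induction with
  | mem x hx =>
    obtain ⟨n, rfl⟩ := hx
    obtain ⟨m, rfl | rfl⟩ := n.eq_nat_or_neg
    · refine ⟨fun w => w ^ m, 0, by fun_prop, by fun_prop, fun θ => ?_⟩
      simp [hfourier, hpow]
    · refine ⟨0, fun w => w ^ m, by fun_prop, by fun_prop, fun θ => ?_⟩
      simp [hfourier, hpow, ← Complex.exp_conj]
  | zero => exact ⟨0, 0, by fun_prop, by fun_prop, fun θ => by simp⟩
  | add x y _ _ hx hy =>
    obtain ⟨p, q, hp, hq, h⟩ := hx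
    obtain ⟨p', q', hp', hq', h'⟩ := hy
    refine ⟨p + p', q + q', hp.add hp', hq.add hq', fun θ => ?_⟩
    simp only [ContinuousMap.add_apply, h, h', Pi.add_apply, map_add]
    ring
  | smul c x _ hx =>
    obtain ⟨p, q, hp, hq, h⟩ := hx
    refine ⟨c • p, (starRingEnd ℂ c) • q, hp.const_smul _, hq.const_smul _, fun θ => ?_⟩
    simp only [ContinuousMap.smul_apply, h, Pi.smul_apply, smul_eq_mul, map_mul, Complex.conj_conj]
    ring

theorem exists_entire_abs_sub_re_lt {g : ℂ → ℝ} (hg : ContinuousOn g (sphere 0 1)) {ε : ℝ}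
    (hε : 0 < ε) :
    ∃ p : ℂ → ℂ, Differentiable ℂ p ∧ ∀ w ∈ sphere (0 : ℂ) 1, |g w - (p w).re| < ε := by
  have : Fact (0 < 2 * π) := ⟨two_pi_pos⟩
  let G : C(AddCircle (2 * π), ℂ) :=
    ⟨fun t => (g (AddCircle.toCircle t : ℂ) : ℂ), Complex.continuous_ofReal.comp
      (hg.comp_continuous (continuous_subtype_val.comp AddCircle.continuous_toCircle)
        fun t => mem_sphere_zero_iff_norm.2 (Circle.norm_coe _))⟩
  have hG : G ∈ (Submodule.span ℂ (range <| @fourier (2 * π))).topologicalClosure := by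
    rw [span_fourier_closure_eq_top]
    trivial
  obtain ⟨T, hT, hGT⟩ := Metric.mem_closure_iff.1 hG ε hε
  obtain ⟨p, q, hp, hq, hTpq⟩ := exists_entire_of_mem_span_fourier hT
  refine ⟨fun w => p w + q w, hp.add hq, fun w hw => ?_⟩
  obtain ⟨θ, rfl⟩ : w ∈ range (circleMap 0 1) := by rwa [range_circleMap, abs_one]
  have hcircle : ((AddCircle.toCircle (θ : AddCircle (2 * π)) : Circle) : ℂ) = circleMap 0 1 θ := by
    rw [AddCircle.toCircle_apply_mk]
    simp [circleMap, Circle.coe_exp]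
  have hre : g (circleMap 0 1 θ) - (p (circleMap 0 1 θ) + q (circleMap 0 1 θ)).re
      = ((G - T) (θ : AddCircle (2 * π))).re := by
    simp [G, hTpq, hcircle]
  rw [hre]
  exact (Complex.abs_re_le_norm _).trans_lt
    ((ContinuousMap.norm_coe_le_norm _ _).trans_lt (by rwa [← dist_eq_norm]))

theorem IsBddPSH.le_re_of_le_on_sphere (hv : IsBddPSH Ω v)
    (hdisc : ∀ w : ℂ, ‖w‖ ≤ 1 → a + w • b ∈ Ω) {p : ℂ → ℂ} (hp : Differentiable ℂ p)
    (h : ∀ w ∈ sphere (0 : ℂ) 1, v (a + w • b) ≤ (p w).re) : v a ≤ (p 0).re := by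
  have hpre : closedBall (0 : ℂ) 1 ⊆ (fun w : ℂ => a + w • b) ⁻¹' Ω :=
    fun w hw => hdisc w (mem_closedBall_zero_iff.1 hw)
  obtain ⟨C, hC⟩ := (isCompact_closedBall (0 : ℂ) 1).exists_bound_of_continuousOn
    (Complex.continuous_re.comp hp.neg.continuous).continuousOn
  have hdiff : IsBddPSH (ball (0 : ℂ) 1) fun w => v (a + w • b) + (-p w).re :=
    ((hv.comp_line a b).mono (ball_subset_closedBall.trans hpre)).add isOpen_ball
      (isBddPSH_re isOpen_ball hp.neg.differentiableOn
        ⟨C, fun z hz => hC z (ball_subset_closedBall hz)⟩)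
  have husc : UpperSemicontinuousOn (fun w => v (a + w • b) + (-p w).re) (closedBall 0 1) :=
    ((hv.comp_line a b).usc.mono hpre).add
      (Complex.continuous_re.comp hp.neg.continuous).continuousOn.upperSemicontinuousOn
  have hle := hdiff.nonpos_of_frontier isOpen_ball isBounded_ball (fun ζ hζ ε hε => ?_) 0 (by simp)
  · rw [zero_smul, add_zero, Complex.neg_re] at hle
    linarith
  · rw [frontier_ball _ one_ne_zero] at hζ
    refine nhdsWithin_mono _ ball_subset_closedBall (husc ζ (sphere_subset_closedBall hζ) ε ?_)
    linarith [h ζ hζ, Complex.neg_re (p ζ)]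

theorem IsBddPSH.le_circleAverage_of_continuousOn (hv : IsBddPSH Ω v)
    (hdisc : ∀ w : ℂ, ‖w‖ ≤ 1 → a + w • b ∈ Ω) {g : ℂ → ℝ} (hg : ContinuousOn g (sphere 0 1))
    (h : ∀ w ∈ sphere (0 : ℂ) 1, v (a + w • b) ≤ g w) : v a ≤ circleAverage g 0 1 := by
  refine le_of_forall_pos_le_add fun ε hε => ?_
  obtain ⟨p, hp, hpg⟩ := exists_entire_abs_sub_re_lt hg (half_pos hε)
  have hle : v a ≤ (p 0 + (ε / 2 : ℝ)).re :=
    hv.le_re_of_le_on_sphere hdisc (hp.add_const _) fun w hw => by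
      rw [Complex.add_re, Complex.ofReal_re]
      linarith [h w hw, (abs_lt.1 (hpg w hw)).2]
  have hint : CircleIntegrable g 0 1 := hg.circleIntegrable zero_le_one
  have havg : (p 0).re ≤ circleAverage g 0 1 + ε / 2 := calc
    (p 0).re = circleAverage (fun w => (p w).re) 0 1 :=
      (circleAverage_re_of_differentiableOn zero_le_one hp.differentiableOn).symm
    _ ≤ circleAverage (fun w => g w + ε / 2) 0 1 := by
      refine circleAverage_mono
        ((Complex.continuous_re.comp hp.continuous).continuousOn.circleIntegrable zero_le_one)
        (hint.add (circleIntegrable_const _ _ _)) fun w hw => ?_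
      rw [abs_one] at hw
      linarith [(abs_lt.1 (hpg w hw)).1]
    _ = circleAverage g 0 1 + ε / 2 := by
      rw [circleAverage_fun_add hint (circleIntegrable_const _ _ _), circleAverage_const]
  rw [Complex.add_re, Complex.ofReal_re] at hle
  linarith

theorem tendsto_circleAverage_supConv {φ : ℂ → ℝ} (hφ : UpperSemicontinuousOn φ (sphere 0 1))
    (hb : ∃ C, ∀ w ∈ sphere (0 : ℂ) 1, |φ w| ≤ C) :
    Tendsto (fun k : ℕ => circleAverage (supConv (sphere 0 1) φ k) 0 1) atTop
      (𝓝 (circleAverage φ 0 1)) := by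
  obtain ⟨C, hC⟩ := hb
  have hφC : ∀ w ∈ sphere (0 : ℂ) 1, φ w ≤ C := fun w hw => (abs_le.1 (hC w hw)).2
  have hmem (θ : ℝ) : circleMap 0 1 θ ∈ sphere (0 : ℂ) 1 := circleMap_mem_sphere 0 zero_le_one θ
  have hbound (k : ℕ) (θ : ℝ) : ‖supConv (sphere 0 1) φ k (circleMap 0 1 θ)‖ ≤ C := by
    refine abs_le.2 ⟨(abs_le.1 (hC _ (hmem θ))).1.trans (le_supConv hφC k.cast_nonneg (hmem θ)),
      supConv_le ⟨_, hmem θ⟩ fun y hy => (hφC y hy).trans (le_add_of_nonneg_right ?_)⟩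
    positivity
  refine (intervalIntegral.tendsto_integral_filter_of_dominated_convergence (fun _ => C)
    (.of_forall fun k => ?_) (.of_forall fun k => .of_forall fun θ _ => hbound k θ)
    intervalIntegrable_const (.of_forall fun θ _ => tendsto_supConv hφ hφC (hmem θ))).const_smul _
  have hlip := lipschitzWith_supConv ⟨1, by simp⟩ hφC k
  exact (hlip.continuous.comp (continuous_circleMap 0 1)).aestronglyMeasurable

theorem IsBddPSH.le_circleAverage (hv : IsBddPSH Ω v) (hdisc : ∀ w : ℂ, ‖w‖ ≤ 1 → a + w • b ∈ Ω) :
    v a ≤ circleAverage (fun w : ℂ => v (a + w • b)) 0 1 := by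
  have hsphere : sphere (0 : ℂ) 1 ⊆ (fun w : ℂ => a + w • b) ⁻¹' Ω :=
    fun w hw => hdisc w (mem_sphere_zero_iff_norm.1 hw).le
  have hslice := (hv.comp_line a b).mono hsphere
  obtain ⟨C, hC⟩ := hslice.bdd
  have hle : ∀ w ∈ sphere (0 : ℂ) 1, v (a + w • b) ≤ C := fun w hw => (abs_le.1 (hC w hw)).2
  refine ge_of_tendsto' (tendsto_circleAverage_supConv hslice.usc ⟨C, hC⟩) fun k => ?_
  have hlip := lipschitzWith_supConv ⟨1, by simp⟩ hle k
  exact hv.le_circleAverage_of_continuousOn hdisc hlip.continuous.continuousOn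
    fun w hw => le_supConv hle k.cast_nonneg hw

end LocalToGlobal

section RayLimit

/-- A harmonic function on the slit plane that dominates `‖u‖` for `‖u‖ ≤ r` and tends to `0` at
the tip of the slit. It serves as a barrier in the slit disc of radius `r`. -/
noncomputable def slitBarrier (r : ℝ) (u : ℂ) : ℝ :=
  ((2 * √r : ℝ) * u ^ (2⁻¹ : ℂ) - u).re

theorem slitBarrier_eq (r : ℝ) (u : ℂ) : slitBarrier r u = 2 * √r * √((‖u‖ + u.re) / 2) - u.re := by
  rw [slitBarrier, Complex.sub_re, Complex.re_ofReal_mul, Complex.cpow_inv_two_re]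

theorem norm_le_slitBarrier {r : ℝ} {u : ℂ} (hu : ‖u‖ ≤ r) : ‖u‖ ≤ slitBarrier r u := by
  have hre := Complex.re_le_norm u
  have hnonneg : 0 ≤ (‖u‖ + u.re) / 2 := by linarith [(abs_le.1 (Complex.abs_re_le_norm u)).1]
  have hle : √((‖u‖ + u.re) / 2) ≤ √r := sqrt_le_sqrt (by linarith)
  have hmul := mul_le_mul_of_nonneg_right hle (sqrt_nonneg ((‖u‖ + u.re) / 2))
  rw [mul_self_sqrt hnonneg] at hmul
  rw [slitBarrier_eq]
  linarith

theorem continuous_slitBarrier (r : ℝ) : Continuous (slitBarrier r) := by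
  simp only [funext (slitBarrier_eq r)]
  fun_prop

theorem isBddPSH_neg_mul_slitBarrier (r k : ℝ) :
    IsBddPSH (ball 0 r ∩ Complex.slitPlane) fun u => -(k * slitBarrier r u) := by
  have hre (u : ℂ) :
      -(k * slitBarrier r u) = (-(k : ℂ) * ((2 * √r : ℝ) * u ^ (2⁻¹ : ℂ) - u)).re := by
    rw [slitBarrier, ← Complex.ofReal_neg, Complex.re_ofReal_mul, neg_mul]
  have hbdd : ∃ C, ∀ u ∈ ball 0 r ∩ Complex.slitPlane, |-(k * slitBarrier r u)| ≤ C := by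
    obtain ⟨C, hC⟩ := (isCompact_closedBall (0 : ℂ) r).exists_bound_of_continuousOn
      (((continuous_slitBarrier r).const_mul k).neg).continuousOn
    exact ⟨C, fun u hu => hC u (ball_subset_closedBall hu.1)⟩
  simp only [hre] at hbdd ⊢
  refine isBddPSH_re (isOpen_ball.inter Complex.isOpen_slitPlane) ?_ hbdd
  have hsqrt : DifferentiableOn ℂ (fun u : ℂ => u ^ (2⁻¹ : ℂ)) (ball 0 r ∩ Complex.slitPlane) :=
    fun u hu => (differentiableAt_id.cpow_const hu.2).differentiableWithinAt
  fun_prop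

theorem IsBddPSH.le_slitBarrier {f : ℂ → ℝ} {r c M : ℝ} (hf : IsBddPSH (ball 0 r) f)
    (hcM : c ≤ M) (hM : ∀ u ∈ ball 0 r, f u ≤ M) (hc : ∀ u ∈ ball 0 r \ Complex.slitPlane, f u ≤ c)
    {u : ℂ} (hu : u ∈ ball 0 r ∩ Complex.slitPlane) :
    f u ≤ c + (M - c) / r * slitBarrier r u := by
  have hopen : IsOpen (ball 0 r ∩ Complex.slitPlane) := isOpen_ball.inter Complex.isOpen_slitPlane
  have hr : 0 < r := pos_of_mem_ball hu.1
  have hk : 0 ≤ (M - c) / r := div_nonneg (sub_nonneg.2 hcM) hr.le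
  have hbarrier : ∀ w ∈ ball (0 : ℂ) r, (M - c) / r * ‖w‖ ≤ (M - c) / r * slitBarrier r w :=
    fun w hw => mul_le_mul_of_nonneg_left (norm_le_slitBarrier (mem_ball_zero_iff.1 hw).le) hk
  have hpsh := ((hf.mono inter_subset_left).sub_const hopen c).add hopen
    (isBddPSH_neg_mul_slitBarrier r ((M - c) / r))
  suffices h : f u - c + -((M - c) / r * slitBarrier r u) ≤ 0 by linarith
  refine hpsh.nonpos_of_frontier hopen (isBounded_ball.subset inter_subset_left)
    (fun ζ hζ ε hε => ?_) u hu
  by_cases hζr : ζ ∈ ball 0 r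
  · have hζslit : ζ ∉ Complex.slitPlane := fun h => hζ.2 (hopen.interior_eq.symm ▸ ⟨hζr, h⟩)
    have hlt : f ζ < c + ε := (hc ζ ⟨hζr, hζslit⟩).trans_lt (lt_add_of_pos_right c hε)
    filter_upwards [nhdsWithin_mono ζ inter_subset_left (hf.usc ζ hζr _ hlt), self_mem_nhdsWithin]
      with w hw hwmem
    have := (mul_nonneg hk (norm_nonneg w)).trans (hbarrier w hwmem.1)
    linarith
  · have hnorm : r ≤ ‖ζ‖ := by simpa using hζr
    have hlt : M - c - ε < (M - c) / r * ‖ζ‖ := calc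
      M - c - ε < (M - c) / r * r := by rw [div_mul_cancel₀ _ hr.ne']; linarith
      _ ≤ (M - c) / r * ‖ζ‖ := mul_le_mul_of_nonneg_left hnorm hk
    have hnear : ∀ᶠ w in 𝓝 ζ, M - c - ε < (M - c) / r * ‖w‖ :=
      (Continuous.tendsto (by fun_prop) ζ).eventually_const_lt hlt
    filter_upwards [nhdsWithin_le_nhds hnear, self_mem_nhdsWithin] with w hw hwmem
    linarith [hM w hwmem.1, hbarrier w hwmem.1]

/-- A ray is not thin at its origin: the slit disc is moved along the ray until its tip reaches
the origin. -/
theorem IsBddPSH.le_of_eventually_le_ray {Ω : Set ℂ} (hΩ : IsOpen Ω) {f : ℂ → ℝ}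
    (hf : IsBddPSH Ω f) (h0 : 0 ∈ Ω) {c : ℝ} (hc : ∀ᶠ t : ℝ in 𝓝[>] 0, f t ≤ c) : f 0 ≤ c := by
  obtain ⟨C, hC⟩ := hf.bdd
  set M := max c C
  obtain ⟨R, hR, hball⟩ := Metric.isOpen_iff.1 hΩ 0 h0
  obtain ⟨T, hT : 0 < T, hray⟩ := mem_nhdsGT_iff_exists_Ioo_subset.1 hc
  set r := min R T / 2
  have hr : 0 < r := half_pos (lt_min hR hT)
  have hrR : 2 * r ≤ R := by simp only [r]; linarith [min_le_left R T]
  have hrT : 2 * r ≤ T := by simp only [r]; linarith [min_le_right R T]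
  have hlim : Tendsto (fun s : ℝ => c + (M - c) / r * slitBarrier r s) (𝓝[>] 0) (𝓝 c) := by
    have hcont : Continuous fun s : ℝ => c + (M - c) / r * slitBarrier r s := by
      have := continuous_slitBarrier r
      fun_prop
    simpa [slitBarrier_eq] using (hcont.tendsto 0).mono_left nhdsWithin_le_nhds
  refine ge_of_tendsto hlim ?_
  filter_upwards [Ioo_mem_nhdsGT hr] with s ⟨hs0, hsr⟩
  have hpre : ball (0 : ℂ) r ⊆ (fun u : ℂ => (s : ℂ) + u • (-1 : ℂ)) ⁻¹' Ω := fun u hu => by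
    have hnorm : ‖(s : ℂ) + u • (-1 : ℂ)‖ ≤ s + ‖u‖ :=
      (norm_add_le _ _).trans_eq (by simp [abs_of_pos hs0])
    exact hball (mem_ball_zero_iff.2 (by linarith [mem_ball_zero_iff.1 hu]))
  have hs : (s : ℂ) ∈ ball 0 r ∩ Complex.slitPlane :=
    ⟨by simpa [abs_of_pos hs0] using hsr, Complex.ofReal_mem_slitPlane.2 hs0⟩
  have hle := ((hf.comp_line s (-1)).mono hpre).le_slitBarrier (le_max_left c C)
    (fun u hu => ((abs_le.1 (hC _ (hpre hu))).2).trans (le_max_right c C)) (fun u hu => ?_) hs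
  · simpa using hle
  · obtain ⟨t, rfl⟩ : ∃ t : ℝ, (t : ℂ) = u :=
      ⟨u.re, Complex.ext rfl (not_not.1 fun h => hu.2 (.inr (Ne.symm h)))⟩
    have ht : t ≤ 0 := not_lt.1 fun h => hu.2 (Complex.ofReal_mem_slitPlane.2 h)
    have htr : -t < r := by simpa [abs_of_nonpos ht] using mem_ball_zero_iff.1 hu.1
    have := hray (show s - t ∈ Ioo 0 T from ⟨by linarith, by linarith⟩)
    simpa [sub_eq_add_neg] using this

theorem IsBddPSH.frequently_lt_homothety (hΩ : IsOpen Ω) (hv : IsBddPSH Ω v) {z : E} (hz : z ∈ Ω)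
    (c : E) {ε : ℝ} (hε : 0 < ε) :
    ∃ᶠ t : ℝ in 𝓝[>] 0, v z - ε < v (AffineMap.homothety c ((1 - t : ℝ) : ℂ) z) := by
  intro hnot
  have hline (t : ℝ) : AffineMap.homothety c ((1 - t : ℝ) : ℂ) z = z + (t : ℂ) • (c - z) := by
    rw [AffineMap.homothety_apply, vsub_eq_sub, vadd_eq_add]
    push_cast
    module
  have hopen : IsOpen ((fun w : ℂ => z + w • (c - z)) ⁻¹' Ω) := hΩ.preimage (by fun_prop)
  have hle := (hv.comp_line z (c - z)).le_of_eventually_le_ray hopen (by simpa using hz)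
    (c := v z - ε) (hnot.mono fun t ht => by rw [← hline]; exact not_lt.1 ht)
  simp only [zero_smul, add_zero] at hle
  linarith

end RayLimit

section Approximation

theorem supConv_mem_Icc {X : Type*} [PseudoMetricSpace X] {D : Set X} {v : X → ℝ} {m M K : ℝ}
    (hv : ∀ y ∈ D, v y ∈ Icc m M) (hK : 0 ≤ K) {z : X} (hz : z ∈ D) : supConv D v K z ∈ Icc m M :=
  have hM : ∀ y ∈ D, v y ≤ M := fun y hy => (hv y hy).2
  ⟨(hv z hz).1.trans (le_supConv hM hK hz),
    supConv_le ⟨z, hz⟩ fun y hy => (hM y hy).trans (le_add_of_nonneg_right (by positivity))⟩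

/-- An apex `y` near the centre of a disc is handled by the sub-mean value inequality on the disc
translated to `y`; an apex at distance at least `ρ` is too far away to matter. -/
theorem isBddPSH_supConv {m M ρ : ℝ} {K : NNReal} (hv : IsBddPSH D v)
    (hvD : ∀ y ∈ D, v y ∈ Icc m M) (hρ : 0 < ρ) (hKρ : M ≤ m + K * ρ) (hΩ : IsOpen Ω)
    (hball : ∀ z ∈ Ω, ball z ρ ⊆ D) : IsBddPSH Ω (supConv D v K) := by
  have hM : ∀ y ∈ D, v y ≤ M := fun y hy => (hvD y hy).2
  have hIcc (z) (hz : z ∈ Ω) := supConv_mem_Icc hvD K.coe_nonneg (hball z hz (mem_ball_self hρ))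
  have hcont : Continuous (supConv D v K) := by
    obtain rfl | hD := D.eq_empty_or_nonempty
    · exact continuous_const.congr fun z => (Real.iSup_of_isEmpty _).symm
    · exact (lipschitzWith_supConv hD hM K).continuous
  refine .of_le_circleAverage hΩ
    ⟨max |m| |M|, fun z hz => abs_le_max_abs_abs (hIcc z hz).1 (hIcc z hz).2⟩
    (hcont.upperSemicontinuous.upperSemicontinuousOn _) fun a b hdisc => ?_
  have ha : a ∈ Ω := by simpa using hdisc 0 (by simp)
  have hint : CircleIntegrable (fun w : ℂ => supConv D v K (a + w • b)) 0 1 :=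
    (Continuous.continuousOn (by fun_prop)).circleIntegrable zero_le_one
  have hsphere (w : ℂ) (hw : w ∈ sphere (0 : ℂ) |1|) : ‖w‖ ≤ 1 := by
    simpa using (mem_sphere_zero_iff_norm.1 hw).le
  refine supConv_le ⟨a, hball a ha (mem_ball_self hρ)⟩ fun y hy => ?_
  obtain hfar | hnear := le_or_gt ρ (dist a y)
  · refine (hM y hy).trans (hKρ.trans (add_le_add ?_ (by gcongr)))
    rw [← circleAverage_const m 0 1]
    exact circleAverage_mono (circleIntegrable_const ..) hint
      fun w hw => (hIcc _ (hdisc w (hsphere w hw))).1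
  · have hmem (w : ℂ) (hw : ‖w‖ ≤ 1) : y + w • b ∈ D :=
      hball _ (hdisc w hw) (by simpa only [mem_ball', dist_add_right] using hnear)
    have hinty : CircleIntegrable (fun w : ℂ => v (y + w • b)) 0 1 :=
      circleIntegrable_slice hv.bdd hv.usc fun w hw => hmem w (hsphere w hw)
    calc v y ≤ circleAverage (fun w : ℂ => v (y + w • b)) 0 1 := hv.le_circleAverage hmem
      _ ≤ circleAverage (fun w : ℂ => supConv D v K (a + w • b) + K * dist a y) 0 1 :=
        circleAverage_mono hinty (hint.add (circleIntegrable_const ..)) fun w hw => by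
          simpa only [dist_add_right, sub_le_iff_le_add] using
            sub_mul_dist_le_supConv (z := a + w • b) hM K.coe_nonneg (hmem w (hsphere w hw))
      _ = circleAverage (fun w : ℂ => supConv D v K (a + w • b)) 0 1 + K * dist a y := by
        rw [circleAverage_fun_add hint (circleIntegrable_const ..), circleAverage_const]

/-- `w` is a competitor in the definition of `ωᶜ(·, A, D)`: a non-positive plurisubharmonic function
on `D`, continuous on the closure and at most `-1` on `A`. -/
structure IsCompetitor (D A : Set E) (w : E → ℝ) : Prop where
  psh : IsBddPSH D w
  nonpos : ∀ z ∈ D, w z ≤ 0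
  continuousOn : ContinuousOn w (closure D)
  le_neg_one : ∀ ζ ∈ A, w ζ ≤ -1

/-- Strong star-shapedness with respect to the point `c`: every contraction of the closure of `D`
towards `c` lies in `D`. -/
def IsStronglyStarShapedAbout (c : E) (D : Set E) : Prop :=
  ∀ r : ℝ, 0 < r → r < 1 → ∀ z ∈ closure D, AffineMap.homothety c (r : ℂ) z ∈ D

theorem IsStronglyStarShapedAbout.exists_homothety {c : E} (hD : IsStronglyStarShapedAbout c D)
    (hΩ : IsOpen D) (hbd : IsBounded D) (hv : IsBddPSH D v) {z : E} (hz : z ∈ D) {τ ε : ℝ}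
    (hτ : 0 < τ) (hε : 0 < ε) :
    ∃ r : ℂ, MapsTo (AffineMap.homothety c r) (closure D) D ∧
      (∀ ζ ∈ closure D, dist (AffineMap.homothety c r ζ) ζ < τ) ∧
      v z - ε < v (AffineMap.homothety c r z) := by
  obtain ⟨R, hR, hDR⟩ := hbd.closure.subset_ball_lt 0 c
  obtain ⟨t, hvt, ht0, ht⟩ := ((hv.frequently_lt_homothety hΩ hz c hε).and_eventually
    (Ioo_mem_nhdsGT (show 0 < min 1 (τ / R) by positivity))).exists
  refine ⟨((1 - t : ℝ) : ℂ), fun ζ hζ => hD (1 - t) ?_ ?_ ζ hζ, fun ζ hζ => ?_, hvt⟩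
  · linarith [ht.trans_le (min_le_left _ _)]
  · linarith
  · have h1 : ‖(1 : ℂ) - ((1 - t : ℝ) : ℂ)‖ = t := by
      rw [← Complex.ofReal_one, ← Complex.ofReal_sub, sub_sub_cancel, Complex.norm_real,
        Real.norm_of_nonneg ht0.le]
    rw [dist_homothety_self, h1]
    calc t * dist c ζ ≤ t * R := by gcongr; exact (mem_ball'.1 (hDR hζ)).le
      _ < τ := (lt_div_iff₀ hR).1 (ht.trans_le (min_le_right _ _))

theorem exists_isOpen_forall_ball_subset {X : Type*} [PseudoMetricSpace X] {S D : Set X}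
    (hS : IsCompact S) (hD : IsOpen D) (hSD : S ⊆ D) {τ : ℝ} (hτ : 0 < τ) :
    ∃ ρ > 0, ρ ≤ τ ∧ ∃ Ω, IsOpen Ω ∧ S ⊆ Ω ∧ ∀ y ∈ Ω, ball y ρ ⊆ D := by
  obtain ⟨δ, hδ, hδD⟩ := hS.exists_thickening_subset_open hD hSD
  set ρ := min (δ / 2) τ
  have hρ : 0 < ρ := by positivity
  have hρδ : ρ + ρ ≤ δ := by linarith [min_le_left (δ / 2) τ]
  refine ⟨ρ, hρ, min_le_right _ _, thickening ρ S, isOpen_thickening,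
    self_subset_thickening hρ S, fun y hy => ?_⟩
  calc ball y ρ ⊆ thickening ρ (thickening ρ S) := ball_subset_thickening hy ρ
    _ ⊆ thickening (ρ + ρ) S := thickening_thickening_subset ρ ρ S
    _ ⊆ D := (thickening_mono hρδ S).trans hδD

theorem IsStronglyStarShapedAbout.exists_isCompetitor [ProperSpace E] {c : E}
    (hD : IsStronglyStarShapedAbout c D) (hΩ : IsOpen D) (hbd : IsBounded D) {A : Set E}
    (hAD : A ⊆ closure D) (hv : IsBddPSH D v) (hvD : ∀ y ∈ D, v y ∈ Icc (-1) 0) {τ ε : ℝ}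
    (hτ : 0 < τ) (hε : 0 < ε) (hvA : ∀ y ∈ D ∩ thickening τ A, v y ≤ -1 + ε) {z : E} (hz : z ∈ D) :
    ∃ w, IsCompetitor D A w ∧ v z - 2 * ε ≤ w z := by
  obtain ⟨r, hmaps, hdist, hvr⟩ := hD.exists_homothety hΩ hbd hv hz (half_pos hτ) hε
  set H := AffineMap.homothety c r
  have hHcont : Continuous H := AffineMap.homothety_continuous c r
  obtain ⟨ρ, hρ, hρτ, Ω, hΩo, hHΩ, hball⟩ := exists_isOpen_forall_ball_subset
    (hbd.isCompact_closure.image hHcont) hΩ hmaps.image_subset (half_pos hτ)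
  let K : NNReal := ⟨ρ⁻¹, by positivity⟩
  have hKρ : (K : ℝ) * ρ = 1 := inv_mul_cancel₀ hρ.ne'
  have hM : ∀ y ∈ D, v y ≤ 0 := fun y hy => (hvD y hy).2
  have hpsh : IsBddPSH Ω (supConv D v K) :=
    isBddPSH_supConv hv hvD hρ (by linarith) hΩo hball
  refine ⟨fun ζ => supConv D v K (H ζ) - ε, ⟨?_, ?_, ?_, ?_⟩, ?_⟩
  · exact ((hpsh.comp_affineMap H hHcont).mono fun y hy =>
      hHΩ (mem_image_of_mem H (subset_closure hy))).sub_const hΩ ε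
  · intro y hy
    have := (supConv_mem_Icc hvD K.coe_nonneg (hmaps (subset_closure hy))).2
    linarith
  · exact (((lipschitzWith_supConv ⟨z, hz⟩ hM K).continuous.comp hHcont).sub
      continuous_const).continuousOn
  · intro ζ hζ
    rw [sub_le_iff_le_add]
    refine supConv_le_of_ball (ρ := ρ) ⟨z, hz⟩ hM K.coe_nonneg (by linarith) fun y ⟨hyD, hy⟩ => ?_
    refine hvA y ⟨hyD, mem_thickening_iff.2 ⟨ζ, hζ, ?_⟩⟩
    calc dist y ζ ≤ dist y (H ζ) + dist (H ζ) ζ := dist_triangle ..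
      _ < ρ + τ / 2 := add_lt_add hy (hdist ζ (hAD hζ))
      _ ≤ τ := by linarith
  · have := le_supConv hM K.coe_nonneg (hmaps (subset_closure hz))
    linarith

/-- Every continuous function on the boundary of `D` is the boundary value of a bounded
plurisubharmonic function on `D` that is continuous on the closure: B-regularity, for real-valued
functions. -/
def HasPSHExtensions (D : Set E) : Prop :=
  ∀ f : E → ℝ, ContinuousOn f (frontier D) →
    ∃ u : E → ℝ, ContinuousOn u (closure D) ∧ IsBddPSH D u ∧ EqOn u f (frontier D)

theorem exists_mem_frontier_dist_lt [ProperSpace E] (hΩ : IsOpen Ω) {y ξ : E}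
    (hy : y ∈ closure Ω) (hξ : ξ ∉ Ω) {s : ℝ} (hyξ : dist y ξ < s) :
    ∃ ζ ∈ frontier Ω, dist y ζ < s := by
  by_cases hyΩ : y ∈ Ω
  · have := FiniteDimensional.of_locallyCompactSpace ℝ (E := E)
    obtain ⟨ζ, hζ, hdist⟩ :=
      exists_mem_frontier_infDist_compl_eq_dist hyΩ fun h => hξ (h ▸ mem_univ ξ)
    exact ⟨ζ, hζ, hdist ▸ (infDist_le_dist_of_mem (mem_compl hξ)).trans_lt hyξ⟩
  · exact ⟨y, hΩ.frontier_eq ▸ ⟨hy, hyΩ⟩, by simpa using dist_nonneg.trans_lt hyξ⟩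

theorem eventually_lt_of_continuousOn_closure {X : Type*} [TopologicalSpace X] {Ω : Set X}
    {u : X → ℝ} (hu : ContinuousOn u (closure Ω)) {ζ : X} (hζ : ζ ∈ frontier Ω) {c : ℝ}
    (hc : u ζ < c) : ∀ᶠ z in 𝓝[Ω] ζ, u z < c :=
  ((hu ζ (frontier_subset_closure hζ)).mono subset_closure).eventually_lt_const hc

theorem IsBddPSH.nonpos_of_continuousOn [ProperSpace E] [Nontrivial E] (hΩ : IsOpen Ω)
    (hbd : IsBounded Ω) (hu : IsBddPSH Ω u) (hc : ContinuousOn u (closure Ω))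
    (hfr : ∀ ζ ∈ frontier Ω, u ζ ≤ 0) : ∀ z ∈ Ω, u z ≤ 0 :=
  hu.nonpos_of_frontier hΩ hbd fun ζ hζ _ hε =>
    eventually_lt_of_continuousOn_closure hc hζ ((hfr ζ hζ).trans_lt hε)

theorem IsBddPSH.add_le_of_thickening [ProperSpace E] [Nontrivial E] (hΩ : IsOpen Ω)
    (hbd : IsBounded Ω) (hu : IsBddPSH Ω u) (hv : IsBddPSH Ω v) (hv0 : ∀ y ∈ Ω, v y ≤ 0)
    {A : Set E} {τ ε : ℝ} (hε : 0 ≤ ε) (hvA : ∀ y ∈ Ω ∩ thickening τ A, v y ≤ -1 + ε)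
    (hc : ContinuousOn u (closure Ω)) (hu1 : ∀ ζ ∈ frontier Ω, u ζ ≤ 1)
    (hu0 : ∀ ζ ∈ frontier Ω, ζ ∉ thickening τ A → u ζ ≤ 0) : ∀ z ∈ Ω, v z + u z ≤ ε := by
  suffices ∀ z ∈ Ω, v z + u z - ε ≤ 0 from fun z hz => sub_nonpos.1 (this z hz)
  refine ((hv.add hΩ hu).sub_const hΩ ε).nonpos_of_frontier hΩ hbd fun ζ hζ η hη => ?_
  by_cases hζA : ζ ∈ thickening τ A
  · filter_upwards [eventually_lt_of_continuousOn_closure hc hζ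
      ((hu1 ζ hζ).trans_lt (lt_add_of_pos_right 1 hη)), self_mem_nhdsWithin,
      mem_nhdsWithin_of_mem_nhds (isOpen_thickening.mem_nhds hζA)] with z huz hz hzA
    linarith [hvA z ⟨hz, hzA⟩]
  · filter_upwards [eventually_lt_of_continuousOn_closure hc hζ ((hu0 ζ hζ hζA).trans_lt hη),
      self_mem_nhdsWithin] with z huz hz
    linarith [hv0 z hz]

theorem IsBddPSH.max_supConv {m M ρ c : ℝ} {K : NNReal} (hΩ : IsOpen Ω) (hu : IsBddPSH Ω u)
    (hv : IsBddPSH Ω v) (hvΩ : ∀ y ∈ Ω, v y ∈ Icc m M) (hρ : 0 < ρ) (hKρ : M ≤ m + K * ρ)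
    (hnear : ∀ y ∈ Ω, ∀ ξ ∉ Ω, dist y ξ < 2 * ρ → supConv Ω v K y - c ≤ u y) :
    IsBddPSH Ω fun y => max (supConv Ω v K y - c) (u y) := by
  have hbdd : ∃ C, ∀ z ∈ Ω, |max (supConv Ω v K z - c) (u z)| ≤ C := by
    obtain ⟨C, hC⟩ := hu.bdd
    refine ⟨max (max |m - c| |M - c|) C, fun z hz =>
      abs_max_le_max_abs_abs.trans (max_le_max ?_ (hC z hz))⟩
    have hz' := supConv_mem_Icc hvΩ K.coe_nonneg hz
    exact abs_le_max_abs_abs (sub_le_sub_right hz'.1 c) (sub_le_sub_right hz'.2 c)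
  refine isBddPSH_of_locally hbdd fun z hz => ?_
  by_cases hball : ball z (2 * ρ) ⊆ Ω
  · have hNΩ : ball z ρ ⊆ Ω := (ball_subset_ball (by linarith)).trans hball
    refine ⟨ball z ρ, isOpen_ball, mem_ball_self hρ, _, IsBddPSH.sup isOpen_ball
      ((isBddPSH_supConv hv hvΩ hρ hKρ isOpen_ball fun y hy => ?_).sub_const isOpen_ball c)
      (hu.mono hNΩ), fun _ _ => rfl⟩
    exact (ball_subset_ball' (by linarith [mem_ball.1 hy])).trans hball
  · obtain ⟨ξ, hξz, hξ⟩ := not_subset.1 hball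
    exact ⟨Ω ∩ ball ξ (2 * ρ), hΩ.inter isOpen_ball, ⟨hz, mem_ball'.2 hξz⟩, u,
      hu.mono inter_subset_left, fun y hy => max_eq_right (hnear y hy.1 ξ hξ hy.2)⟩

theorem supConv_sub_le_of_frontier [ProperSpace E] {w : E → ℝ} {ρ ε : ℝ} {K : NNReal}
    (hΩ : IsOpen Ω) (hε : 0 ≤ ε) (hρ : 0 ≤ ρ) (hKρ : 1 ≤ K * ρ) (hv0 : ∀ y ∈ Ω, v y ≤ 0)
    (hvw : ∀ y ∈ Ω, v y + w y ≤ ε) (hu1 : ∀ ζ ∈ frontier Ω, -1 ≤ u ζ)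
    (huw : ∀ ζ ∈ frontier Ω, u ζ + w ζ = 0)
    (hosc : ∀ x ∈ closure Ω, ∀ y ∈ closure Ω, dist x y < 3 * ρ →
      |u x - u y| < ε ∧ |w x - w y| < ε)
    {y ξ : E} (hy : y ∈ closure Ω) (hξ : ξ ∉ Ω) (hyξ : dist y ξ < 2 * ρ) :
    supConv Ω v K y - 3 * ε ≤ u y := by
  obtain ⟨ζ, hζ, hyζ⟩ := exists_mem_frontier_dist_lt hΩ hy hξ hyξ
  have hζΩ := frontier_subset_closure hζ
  have huy := (abs_lt.1 (hosc y hy ζ hζΩ (by linarith)).1).1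
  have hu1ζ := hu1 ζ hζ
  rw [sub_le_iff_le_add]
  refine supConv_le_of_ball (ρ := ρ) (closure_nonempty_iff.1 ⟨y, hy⟩) hv0 K.coe_nonneg
    (by linarith) fun x ⟨hx, hxy⟩ => ?_
  have hxζ : dist x ζ < 3 * ρ := by linarith [dist_triangle x y ζ, mem_ball.1 hxy]
  have hwx := (abs_lt.1 (hosc x (subset_closure hx) ζ hζΩ hxζ).2).1
  linarith [huw ζ hζ, hvw x hx]

theorem exists_forall_dist_lt_of_continuousOn {X : Type*} [PseudoMetricSpace X] {S : Set X}
    (hS : IsCompact S) {u w : X → ℝ} (hu : ContinuousOn u S) (hw : ContinuousOn w S) {ε : ℝ}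
    (hε : 0 < ε) : ∃ δ > 0, ∀ x ∈ S, ∀ y ∈ S, dist x y < δ → |u x - u y| < ε ∧ |w x - w y| < ε := by
  obtain ⟨δ, hδ, h⟩ := Metric.uniformContinuousOn_iff.1
    (hS.uniformContinuousOn_of_continuous (hu.prodMk hw)) ε hε
  exact ⟨δ, hδ, fun x hx y hy hxy => max_lt_iff.1 (h x hx y hy hxy)⟩

theorem HasPSHExtensions.exists_isCompetitor [ProperSpace E] [Nontrivial E]
    (hD : HasPSHExtensions D) (hΩ : IsOpen D) (hbd : IsBounded D) {A : Set E}
    (hAD : A ⊆ frontier D) (hv : IsBddPSH D v) (hvD : ∀ y ∈ D, v y ∈ Icc (-1) 0) {τ ε : ℝ}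
    (hτ : 0 < τ) (hε : 0 < ε) (hvA : ∀ y ∈ D ∩ thickening τ A, v y ≤ -1 + ε) {z : E} (hz : z ∈ D) :
    ∃ w, IsCompetitor D A w ∧ v z - 3 * ε ≤ w z := by
  let χ : E → ℝ := fun x => thickenedIndicator hτ A x
  have hχ : Continuous χ := NNReal.continuous_coe.comp (thickenedIndicator hτ A).continuous
  have hχ1 (x : E) : χ x ≤ 1 := thickenedIndicator_le_one hτ A x
  have hχ0 (x : E) : 0 ≤ χ x := NNReal.coe_nonneg _
  have hχA (x : E) (hx : x ∈ A) : χ x = 1 :=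
    congrArg NNReal.toReal (thickenedIndicator_one hτ A hx)
  obtain ⟨u, huc, hu, huχ⟩ := hD (fun x => -χ x) hχ.neg.continuousOn
  obtain ⟨w, hwc, hw, hwχ⟩ := hD χ hχ.continuousOn
  have hM : ∀ y ∈ D, v y ≤ 0 := fun y hy => (hvD y hy).2
  have hu0 : ∀ y ∈ D, u y ≤ 0 := hu.nonpos_of_continuousOn hΩ hbd huc fun ζ hζ =>
    (huχ hζ).trans_le (neg_nonpos.2 (hχ0 ζ))
  have hvw : ∀ y ∈ D, v y + w y ≤ ε := hw.add_le_of_thickening hΩ hbd hv hM hε.le hvA hwc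
    (fun ζ hζ => (hwχ hζ).trans_le (hχ1 ζ))
    fun ζ hζ hζA => ((hwχ hζ).trans (congrArg NNReal.toReal (thickenedIndicator_zero hτ A hζA))).le
  obtain ⟨δ, hδ, hosc⟩ := exists_forall_dist_lt_of_continuousOn hbd.isCompact_closure huc hwc hε
  obtain ⟨ρ, rfl⟩ : ∃ ρ, δ = 3 * ρ := ⟨δ / 3, by ring⟩
  have hρ : 0 < ρ := by linarith
  let K : NNReal := ⟨ρ⁻¹, by positivity⟩
  have hKρ : (K : ℝ) * ρ = 1 := inv_mul_cancel₀ hρ.ne'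
  have hnear : ∀ y ∈ closure D, ∀ ξ ∉ D, dist y ξ < 2 * ρ → supConv D v K y - 3 * ε ≤ u y :=
    fun y hy ξ hξ hyξ => supConv_sub_le_of_frontier hΩ hε.le hρ.le hKρ.ge hM hvw
      (fun ζ hζ => by linarith [huχ hζ, hχ1 ζ]) (fun ζ hζ => by linarith [huχ hζ, hwχ hζ])
      hosc hy hξ hyξ
  refine ⟨fun y => max (supConv D v K y - 3 * ε) (u y), ⟨?_, ?_, ?_, ?_⟩, ?_⟩
  · exact hu.max_supConv hΩ hv hvD hρ (by linarith) fun y hy => hnear y (subset_closure hy)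
  · intro y hy
    have := (supConv_mem_Icc hvD K.coe_nonneg hy).2
    exact max_le (by linarith) (hu0 y hy)
  · exact ((lipschitzWith_supConv ⟨z, hz⟩ hM K).continuous.continuousOn.sub
      continuousOn_const).sup huc
  · intro ζ hζ
    have hζD := hΩ.frontier_eq ▸ hAD hζ
    refine max_le ((hnear ζ hζD.1 ζ hζD.2 (by simpa using hρ)).trans ?_) ?_ <;>
      linarith [huχ (hAD hζ), hχA ζ hζ]
  · have := le_supConv hM K.coe_nonneg hz
    exact le_max_of_le_left (by linarith)

end Approximation

section ExtendedReal

theorem eintegral_mono {X : Type*} [MeasurableSpace X] (μ : Measure X) {f g : X → EReal}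
    (h : ∀ x, f x ≤ g x) : eintegral μ f ≤ eintegral μ g := by
  refine EReal.sub_le_sub ?_ ?_ <;>
    refine EReal.coe_ennreal_le_coe_ennreal_iff.2
      (lintegral_mono fun x => EReal.toENNReal_le_toENNReal ?_)
  · exact h x
  · exact EReal.neg_le_neg_iff.2 (h x)

theorem eintegral_coe {X : Type*} [MeasurableSpace X] {μ : Measure X} {f : X → ℝ}
    (hf : Integrable f μ) : eintegral μ (fun x => (f x : EReal)) = ((∫ x, f x ∂μ : ℝ) : EReal) := by
  have hfin {g : X → ℝ} (hg : Integrable g μ) : ∫⁻ x, ENNReal.ofReal (g x) ∂μ ≠ ⊤ :=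
    ((lintegral_mono fun x => ofReal_le_enorm (g x)).trans_lt hg.2).ne
  rw [integral_eq_lintegral_pos_part_sub_lintegral_neg_part hf, EReal.coe_sub,
    EReal.coe_ennreal_toReal (hfin hf), EReal.coe_ennreal_toReal (hfin hf.fun_neg)]
  simp only [eintegral, ← EReal.coe_neg, EReal.toENNReal, EReal.coe_ne_top, if_false,
    EReal.toReal_coe]

theorem eintegral_arcMeasure_coe {g : ℂ → ℝ} (hg : CircleIntegrable g 0 1) :
    eintegral arcMeasure (fun θ : ℝ => (g (Complex.exp (θ * Complex.I)) : EReal)) =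
      (circleAverage g 0 1 : ℝ) := by
  have hexp (θ : ℝ) : Complex.exp (θ * Complex.I) = circleMap 0 1 θ := by simp [circleMap]
  simp only [hexp]
  rw [CircleIntegrable, intervalIntegrable_iff_integrableOn_Ioc_of_le two_pi_pos.le] at hg
  rw [arcMeasure, eintegral_coe (hg.smul_measure ENNReal.ofReal_ne_top), integral_smul_measure,
    ENNReal.toReal_ofReal (by positivity), circleAverage_def,
    intervalIntegral.integral_of_le two_pi_pos.le]

/-- The function `max u (-1)`, as a real-valued function; meaningful where `u` does not take the
value `⊤`. -/
noncomputable def truncate {X : Type*} (u : X → EReal) (z : X) : ℝ :=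
  (max (u z) (-1 : ℝ)).toReal

section Truncate

variable {X : Type*} {u : X → EReal} {z : X}

theorem coe_truncate (h : u z ≠ ⊤) : (truncate u z : EReal) = max (u z) (-1 : ℝ) :=
  EReal.coe_toReal (max_lt h.lt_top (EReal.coe_lt_top _)).ne
    ((EReal.bot_lt_coe (-1)).trans_le (le_max_right _ _)).ne'

theorem le_truncate (h : u z ≠ ⊤) : u z ≤ truncate u z :=
  coe_truncate h ▸ le_max_left _ _

theorem truncate_mem_Icc (h : u z ≤ 0) : truncate u z ∈ Icc (-1 : ℝ) 0 := by
  simp only [mem_Icc, ← EReal.coe_le_coe_iff, coe_truncate (h.trans_lt EReal.zero_lt_top).ne]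
  exact ⟨le_max_right _ _, max_le h (by simp)⟩

theorem truncate_lt_iff (h : u z ≠ ⊤) {c : ℝ} (hc : -1 < c) : truncate u z < c ↔ u z < c := by
  rw [← EReal.coe_lt_coe_iff, coe_truncate h, max_lt_iff,
    and_iff_left (EReal.coe_lt_coe_iff.2 hc)]

end Truncate

section ComplexSpace

variable {n : ℕ} {D A : Set (Fin n → ℂ)}

theorem IsBddPSH.isPSH {v : (Fin n → ℂ) → ℝ} (hv : IsBddPSH D v) :
    IsPSH D (fun z => (v z : EReal)) where
  lt_top _ _ := EReal.coe_lt_top _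
  usc := continuous_coe_real_ereal.comp_upperSemicontinuousOn hv.usc EReal.coe_strictMono.monotone
  submean a b hdisc := by
    rw [eintegral_arcMeasure_coe (g := fun w : ℂ => v (a + w • b))
      (circleIntegrable_slice hv.bdd hv.usc fun w hw => hdisc w (by simpa using hw.le))]
    exact EReal.coe_le_coe_iff.2 (hv.le_circleAverage hdisc)

theorem IsPSH.isBddPSH {v : (Fin n → ℂ) → ℝ} (hD : IsOpen D) (hb : ∃ C, ∀ z ∈ D, |v z| ≤ C)
    (hu : UpperSemicontinuousOn v D) (hv : IsPSH D (fun z => (v z : EReal))) : IsBddPSH D v :=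
  .of_le_circleAverage hD hb hu fun a b hdisc => by
    have hint : CircleIntegrable (fun w : ℂ => v (a + w • b)) 0 1 :=
      circleIntegrable_slice hb hu fun w hw => hdisc w (by simpa using hw.le)
    rw [← EReal.coe_le_coe_iff, ← eintegral_arcMeasure_coe hint]
    exact hv.submean a b hdisc

theorem IsPSH.isBddPSH_truncate {u : (Fin n → ℂ) → EReal} (hD : IsOpen D) (hu : IsPSH D u)
    (h0 : ∀ z ∈ D, u z ≤ 0) : IsBddPSH D (truncate u) := by
  have htop (z) (hz : z ∈ D) : u z ≠ ⊤ := (hu.lt_top z hz).ne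
  have hIcc (z) (hz : z ∈ D) := truncate_mem_Icc (h0 z hz)
  have hb : ∃ C, ∀ z ∈ D, |truncate u z| ≤ C :=
    ⟨1, fun z hz => abs_le.2 ⟨(hIcc z hz).1, (hIcc z hz).2.trans zero_le_one⟩⟩
  have husc : UpperSemicontinuousOn (truncate u) D := fun z hz y hy => by
    have hy1 : -1 < y := (hIcc z hz).1.trans_lt hy
    filter_upwards [hu.usc z hz y ((truncate_lt_iff (htop z hz) hy1).1 hy), self_mem_nhdsWithin]
      with x hx hxD
    exact (truncate_lt_iff (htop x hxD) hy1).2 hx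
  refine .of_le_circleAverage hD hb husc fun a b hdisc => ?_
  have hsphere (w : ℂ) (hw : w ∈ sphere (0 : ℂ) |1|) : a + w • b ∈ D :=
    hdisc w (by simpa using (mem_sphere_zero_iff_norm.1 hw).le)
  have hint : CircleIntegrable (fun w : ℂ => truncate u (a + w • b)) 0 1 :=
    circleIntegrable_slice hb husc hsphere
  rw [← EReal.coe_le_coe_iff, coe_truncate (htop a (by simpa using hdisc 0 (by simp)))]
  refine max_le ?_ (EReal.coe_le_coe_iff.2 ?_)
  · rw [← eintegral_arcMeasure_coe hint]
    exact (hu.submean a b hdisc).trans (eintegral_mono _ fun θ =>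
      le_truncate (htop _ (hdisc _ (Complex.norm_exp_ofReal_mul_I θ).le)))
  · rw [← circleAverage_const (-1 : ℝ) 0 1]
    exact circleAverage_mono (circleIntegrable_const ..) hint fun w hw =>
      (hIcc _ (hsphere w hw)).1

theorem IsBRegular.hasPSHExtensions (hreg : IsBRegular D) (hD : IsOpen D) (hbd : IsBounded D) :
    HasPSHExtensions D := fun f hf => by
  obtain ⟨u, huc, hu, huf⟩ := hreg f hf
  obtain ⟨C, hC⟩ := hbd.isCompact_closure.exists_bound_of_continuousOn huc
  exact ⟨u, huc, hu.isBddPSH hD ⟨C, fun z hz => hC z (subset_closure hz)⟩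
    (huc.mono subset_closure).upperSemicontinuousOn, huf⟩

theorem IsStronglyStarShaped.about_zero (h : IsStronglyStarShaped D) :
    IsStronglyStarShapedAbout 0 D := fun r h0 h1 z hz => by
  simpa [AffineMap.homothety_apply] using h r h0 h1 z hz

theorem IsPolydisc.exists_isStronglyStarShapedAbout (h : IsPolydisc D) :
    ∃ c, IsStronglyStarShapedAbout c D := by
  obtain ⟨c, ρ, hρ, rfl⟩ := h
  refine ⟨c, fun r hr0 hr1 z hz i => ?_⟩
  have hclosed : IsClosed {z : Fin n → ℂ | ∀ i, ‖z i - c i‖ ≤ ρ i} := by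
    simp only [ofPred_forall]
    exact isClosed_iInter fun i => isClosed_le (by fun_prop) continuous_const
  have hzi : ‖z i - c i‖ ≤ ρ i := closure_minimal (fun z hz i => (hz i).le) hclosed hz i
  calc ‖AffineMap.homothety c (r : ℂ) z i - c i‖ = r * ‖z i - c i‖ := by
        simp [AffineMap.homothety_apply, abs_of_pos hr0]
    _ ≤ r * ρ i := by gcongr
    _ < ρ i := mul_lt_of_lt_one_left (hρ i) hr1

theorem IsCompetitor.le_omegaC {w : (Fin n → ℂ) → ℝ} (hw : IsCompetitor D A w) (z : Fin n → ℂ) :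
    (w z : EReal) ≤ omegaC z A D :=
  le_sSup ⟨w, hw.psh.isPSH, hw.nonpos, hw.continuousOn, hw.le_neg_one, rfl⟩

theorem omegaC_le_omega (hAD : A ⊆ closure D) (z : Fin n → ℂ) : omegaC z A D ≤ omega z A D := by
  refine sSup_le_sSup ?_
  rintro t ⟨u, hu, h0, hc, hA, rfl⟩
  refine ⟨fun w => (u w : EReal), hu, fun w hw => EReal.coe_nonpos.2 (h0 w hw), fun ζ hζ => ?_, rfl⟩
  have : (𝓝[D] ζ).NeBot := mem_closure_iff_nhdsWithin_neBot.1 (hAD hζ)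
  have hlim : Tendsto (fun w => (u w : EReal)) (𝓝[D] ζ) (𝓝 (u ζ : EReal)) :=
    (continuous_coe_real_ereal.tendsto _).comp ((hc ζ (hAD hζ)).mono subset_closure)
  rw [upperReg, hlim.limsup_eq]
  simpa using EReal.coe_le_coe_iff.2 (hA ζ hζ)

theorem exists_truncate_le_of_upperReg_le (hA : IsCompact A) {u : (Fin n → ℂ) → EReal}
    (hu : ∀ z ∈ D, u z < ⊤) (huA : ∀ ζ ∈ A, upperReg D u ζ ≤ -1) {ε : ℝ} (hε : 0 < ε) :
    ∃ τ > 0, ∀ z ∈ D ∩ thickening τ A, truncate u z ≤ -1 + ε := by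
  have hε1 : -1 < -1 + ε := by linarith
  have hsub : A ⊆ interior {z | z ∈ D → truncate u z ≤ -1 + ε} := fun ζ hζ => by
    rw [mem_interior_iff_mem_nhds]
    have hlimsup : limsup u (𝓝[D] ζ) < ((-1 + ε : ℝ) : EReal) :=
      (huA ζ hζ).trans_lt (by simpa using EReal.coe_lt_coe_iff.2 hε1)
    filter_upwards [eventually_nhdsWithin_iff.1 (eventually_lt_of_limsup_lt hlimsup)] with z hz hzD
    exact ((truncate_lt_iff (hu z hzD).ne hε1).2 (hz hzD)).le
  obtain ⟨τ, hτ, h⟩ := hA.exists_thickening_subset_open isOpen_interior hsub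
  exact ⟨τ, hτ, fun z hz => interior_subset (h hz.2) hz.1⟩

theorem omega_le_omegaC_of_exists_isCompetitor (hD : IsOpen D) (hA : IsCompact A) {z : Fin n → ℂ}
    (hz : z ∈ D) (h : ∀ v : (Fin n → ℂ) → ℝ, IsBddPSH D v → (∀ y ∈ D, v y ∈ Icc (-1) 0) →
      ∀ τ > 0, ∀ ε > 0, (∀ y ∈ D ∩ thickening τ A, v y ≤ -1 + ε) →
        ∃ w, IsCompetitor D A w ∧ v z - 3 * ε ≤ w z) :
    omega z A D ≤ omegaC z A D := by
  refine sSup_le ?_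
  rintro _ ⟨u, hu, h0, huA, rfl⟩
  refine (le_truncate (hu.lt_top z hz).ne).trans (EReal.ge_of_forall_gt_iff_ge.1 fun x hx => ?_)
  have hε : 0 < (truncate u z - x) / 3 := by linarith [EReal.coe_lt_coe_iff.1 hx]
  obtain ⟨τ, hτ, hnear⟩ := exists_truncate_le_of_upperReg_le hA hu.lt_top huA hε
  obtain ⟨w, hw, hvw⟩ := h _ (hu.isBddPSH_truncate hD h0)
    (fun y hy => truncate_mem_Icc (h0 y hy)) τ hτ _ hε hnear
  exact (EReal.coe_le_coe_iff.2 (by linarith)).trans (hw.le_omegaC z)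

theorem isCompetitor_zero_empty : IsCompetitor D ∅ fun _ => 0 where
  psh := isBddPSH_const D 0
  nonpos _ _ := le_rfl
  continuousOn := continuousOn_const
  le_neg_one _ h := h.elim

end ComplexSpace

end ExtendedReal

end PluriExtremal

open PluriExtremal in
theorem mainTheorem5_general {n : ℕ} (D : Set (Fin n → ℂ)) (hD_open : IsOpen D)
    (hD_bdd : Bornology.IsBounded D) (hD : IsBRegular D ∨ ∃ c, IsStronglyStarShapedAbout c D)
    (A : Set (Fin n → ℂ)) (hA_sub : A ⊆ frontier D) (hA : IsCompact A) :
    ∀ z ∈ D, omega z A D = omegaC z A D := by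
  intro z hz
  refine le_antisymm ?_ (omegaC_le_omega (hA_sub.trans frontier_subset_closure) z)
  refine omega_le_omegaC_of_exists_isCompetitor hD_open hA hz fun v hv hvD τ hτ ε hε hvA => ?_
  obtain rfl | ⟨ζ, hζ⟩ := A.eq_empty_or_nonempty
  · exact ⟨_, isCompetitor_zero_empty, by linarith [(hvD z hz).2]⟩
  obtain hreg | ⟨c, hc⟩ := hD
  · have : Nontrivial (Fin n → ℂ) :=
      ⟨z, ζ, fun h => (hD_open.frontier_eq ▸ hA_sub hζ).2 (h ▸ hz)⟩
    exact (hreg.hasPSHExtensions hD_open hD_bdd).exists_isCompetitor hD_open hD_bdd hA_sub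
      hv hvD hτ hε hvA hz
  · obtain ⟨w, hw, hvw⟩ := hc.exists_isCompetitor hD_open hD_bdd
      (hA_sub.trans frontier_subset_closure) hv hvD hτ hε hvA hz
    exact ⟨w, hw, by linarith⟩

theorem mainTheorem5 {n : ℕ} (D : Set (Fin n → ℂ))
    (hD_open : IsOpen D) (hD_conn : IsConnected D) (hD_bdd : Bornology.IsBounded D)
    (hD : PluriExtremal.IsBRegular D ∨ PluriExtremal.IsStronglyStarShaped D ∨
      PluriExtremal.IsPolydisc D)
    (A : Set (Fin n → ℂ)) (hA_sub : A ⊆ frontier D) (hA : IsCompact A) :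
    ∀ z ∈ D, PluriExtremal.omega z A D = PluriExtremal.omegaC z A D :=
  mainTheorem5_general D hD_open hD_bdd (hD.imp_right fun h =>
    h.elim (fun hstar => ⟨0, hstar.about_zero⟩) (·.exists_isStronglyStarShapedAbout)) A hA_sub hA
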